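/- Let $\mathbb F$ be a non-archimedean local field of characteristic zero and let $n\ge 0$ be an integer. For a Hausdorff, locally compact, totally disconnected space $Z$ let $\mathcal S(Z)$ be the space of locally constant compactly supported functions $Z\to\mathbb C$; a distribution on $Z$ is a linear functional $\mathcal S(Z)\to\mathbb C$. A homeomorphism $e$ of $Z$ acts on distributions by $(e\,\xi)(f)=\xi(f\circ e)$. Let $G_n=\mathrm{GL}(n,\mathbb F)$ and let $\widetilde G_n=G_n\rtimes S_2$, where the generator $T$ of $S_2$ acts on $G_n$ by $g\mapsto {}^tg^{-1}$; let $\chi(g,s)=\mathrm{sign}(s)$. Let $V=\mathbb F^n$ (column vectors), let $V^*$ be its dual (row vectors), and let $X_n=\mathrm{sl}(V)\times V\times V^*$, where $\mathrm{sl}(V)$ is the space of $n\times n$ matrices of trace zero. The group $\widetilde G_n$ acts on $X_n$ by $$g(A,v,\phi)=(gAg^{-1},\,gv,\,\phi g^{-1})\quad (g\in G_n),\qquad T(A,v,\phi)=({}^tA,\,{}^t\phi,\,{}^tv).$$ Suppose that every $(\widetilde G_n,\chi)$-equivariant distribution on $X_n$ is zero, that is: if $h\,\xi=\chi(h)\,\xi$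 for all $h\in\widetilde G_n$, then $\xi=0$. Then every distribution on $\mathrm{GL}(n+1,\mathbb F)$ that is invariant under conjugation by $\mathrm{GL}(n,\mathbb F)$, embedded by $g\mapsto\begin{pmatrix} g&0\\0&1\end{pmatrix}$, is invariant under transposition $x\mapsto {}^tx$. -/

import Mathlib

open Matrix

noncomputable section

namespace MultOne

/-! ### Schwartz functions and distributions on an `l`-space -/

/-- The space `𝒮(Z)` of Schwartz functions: locally constant, compactly supported functions
`Z → ℂ`. -/
def SchwartzFun (Z : Type*) [TopologicalSpace Z] : Submodule ℂ (Z → ℂ) where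
  carrier := {f | IsLocallyConstant f ∧ HasCompactSupport f}
  add_mem' := fun hf hg => ⟨hf.1.add hg.1, hf.2.add hg.2⟩
  zero_mem' := ⟨IsLocallyConstant.const 0, HasCompactSupport.zero⟩
  smul_mem' := fun c _ hf =>
    ⟨hf.1.comp (fun z => c • z), hf.2.comp_left (g := fun z => c • z) (smul_zero c)⟩

/-- The space `𝒮*(Z)` of distributions: all linear functionals on `𝒮(Z)`. -/
abbrev Distribution (Z : Type*) [TopologicalSpace Z] : Type _ := Module.Dual ℂ (SchwartzFun Z)

/-- Pullback of Schwartz functions along a homeomorphism, `f ↦ f ∘ e`. -/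
def SchwartzFun.comap {Z Z' : Type*} [TopologicalSpace Z] [TopologicalSpace Z'] (e : Z ≃ₜ Z') :
    SchwartzFun Z' →ₗ[ℂ] SchwartzFun Z where
  toFun f := ⟨fun z => f.1 (e z),
    f.2.1.comp_continuous e.continuous, f.2.2.comp_homeomorph e⟩
  map_add' _ _ := rfl
  map_smul' _ _ := rfl

/-- Push-forward of distributions along a homeomorphism, `(e ξ)(f) = ξ (f ∘ e)`. -/
def Distribution.map {Z Z' : Type*} [TopologicalSpace Z] [TopologicalSpace Z'] (e : Z ≃ₜ Z')
    (ξ : Distribution Z) : Distribution Z' :=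
  ξ ∘ₗ SchwartzFun.comap e

/-- `ξ` is `(H, μ)`-equivariant: `h ξ = μ(h) ξ` for all `h ∈ H`. -/
def Distribution.IsEquivariant {H Z : Type*} [Group H] [TopologicalSpace Z] [MulAction H Z]
    [ContinuousConstSMul H Z] (μ : H →* ℂˣ) (ξ : Distribution Z) : Prop :=
  ∀ h : H, Distribution.map (Homeomorph.smul h) ξ = (μ h : ℂ) • ξ

/-! ### The group `GL_n`, its embedding in `GL_{n+1}`, transposition and conjugation -/

section Algebra

variable {F : Type*} [Field F] {n : ℕ}

/-- The transpose of an invertible matrix, as an invertible matrix. -/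
def transposeGL (g : GL (Fin n) F) : GL (Fin n) F where
  val := (g : Matrix (Fin n) (Fin n) F)ᵀ
  inv := ((g⁻¹ : GL (Fin n) F) : Matrix (Fin n) (Fin n) F)ᵀ
  val_inv := by rw [← transpose_mul, Units.inv_mul, transpose_one]
  inv_val := by rw [← transpose_mul, Units.mul_inv, transpose_one]

lemma transposeGL_mul (g h : GL (Fin n) F) :
    transposeGL (g * h) = transposeGL h * transposeGL g :=
  Units.ext (transpose_mul _ _)

lemma transposeGL_transposeGL (g : GL (Fin n) F) : transposeGL (transposeGL g) = g :=
  Units.ext (transpose_transpose _)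

lemma transposeGL_inv (g : GL (Fin n) F) : transposeGL g⁻¹ = (transposeGL g)⁻¹ :=
  Units.ext rfl

/-- The involution `g ↦ ᵗg⁻¹` of `GL_n`. -/
def contragredient : MulAut (GL (Fin n) F) where
  toFun g := transposeGL g⁻¹
  invFun g := transposeGL g⁻¹
  left_inv g := by
    change transposeGL (transposeGL g⁻¹)⁻¹ = g
    rw [← transposeGL_inv, inv_inv, transposeGL_transposeGL]
  right_inv g := by
    change transposeGL (transposeGL g⁻¹)⁻¹ = g
    rw [← transposeGL_inv, inv_inv, transposeGL_transposeGL]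
  map_mul' g h := by rw [_root_.mul_inv_rev, transposeGL_mul]

lemma contragredient_mul_self :
    (contragredient * contragredient : MulAut (GL (Fin n) F)) = 1 :=
  MulEquiv.ext fun g => contragredient.left_inv g

lemma perm_two_eq (s : Equiv.Perm (Fin 2)) : s = 1 ∨ s = Equiv.swap 0 1 := by
  revert s; decide

variable (F n) in
/-- The action of the two-element group `S₂` on `GL_n` whose generator acts by `g ↦ ᵗg⁻¹`. -/
def permAct : Equiv.Perm (Fin 2) →* MulAut (GL (Fin n) F) where
  toFun s := if s = 1 then 1 else contragredient
  map_one' := if_pos rfl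
  map_mul' s t := by
    rcases perm_two_eq s with rfl | rfl <;> rcases perm_two_eq t with rfl | rfl <;>
      simp [contragredient_mul_self]

variable (F n) in
/-- The group `G̃_n = GL_n ⋊ S₂`. -/
abbrev GTilde : Type _ := GL (Fin n) F ⋊[permAct F n] Equiv.Perm (Fin 2)

variable (F n) in
/-- The character `χ(g, s) = sign s` of `G̃_n`. -/
def chi : GTilde F n →* ℂˣ :=
  (Units.map (Int.castRingHom ℂ : ℤ →* ℂ)).comp (Equiv.Perm.sign.comp SemidirectProduct.rightHom)

variable (F n) in
/-- The standard embedding of `GL_n` in `GL_{n+1}`, `g ↦ diag(g, 1)`. -/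
def embGL : GL (Fin n) F →* GL (Fin (n + 1)) F :=
  Units.map
    { toFun := fun A => reindex finSumFinEquiv finSumFinEquiv
        (fromBlocks A 0 0 (1 : Matrix (Fin 1) (Fin 1) F))
      map_one' := by
        rw [fromBlocks_one, reindex_apply, submatrix_one_equiv]
      map_mul' := fun A B => by
        rw [reindex_apply, reindex_apply, reindex_apply, submatrix_mul_equiv, fromBlocks_multiply]
        simp }

/-! ### The space `X_n` and the action of `G̃_n` on it -/

variable (F n) in
/-- The space `sl_n` of trace-zero matrices. -/
abbrev sl : Submodule F (Matrix (Fin n) (Fin n) F) :=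
  LinearMap.ker (traceLinearMap (Fin n) F F)

variable (F n) in
/-- `X_n = sl_n × V × V*`, where `V = Fⁿ` consists of column vectors and `V*` of row vectors. -/
abbrev X : Type _ := sl F n × (Fin n → F) × (Fin n → F)

/-- `g (A, v, φ) = (g A g⁻¹, g v, (g⁻¹)^* φ)`; the row vector of `(g⁻¹)^* φ = φ ∘ g⁻¹` is
`φ g⁻¹`. -/
def glAct (g : GL (Fin n) F) (x : X F n) : X F n :=
  (⟨g.val * x.1.val * g⁻¹.val, by
      have h : trace x.1.val = 0 := x.1.2
      rw [LinearMap.mem_ker, traceLinearMap_apply, trace_mul_comm, ← mul_assoc, Units.inv_mul,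
        one_mul, h]⟩,
    g.val *ᵥ x.2.1, x.2.2 ᵥ* g⁻¹.val)

/-- `T (A, v, φ) = (ᵗA, ᵗφ, ᵗv)`. -/
def tAct (x : X F n) : X F n :=
  (⟨x.1.valᵀ, by
      have h : trace x.1.val = 0 := x.1.2
      rw [LinearMap.mem_ker, traceLinearMap_apply, trace_transpose, h]⟩,
    x.2.2, x.2.1)

lemma glAct_one (x : X F n) : glAct 1 x = x := by
  refine Prod.ext (Subtype.ext ?_) (Prod.ext ?_ ?_) <;> simp [glAct]

lemma glAct_mul (g h : GL (Fin n) F) (x : X F n) : glAct (g * h) x = glAct g (glAct h x) := by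
  refine Prod.ext (Subtype.ext ?_) (Prod.ext ?_ ?_)
  · simp only [glAct, _root_.mul_inv_rev, Units.val_mul, mul_assoc]
  · simp only [glAct, Units.val_mul, mulVec_mulVec]
  · simp only [glAct, _root_.mul_inv_rev, Units.val_mul, vecMul_vecMul]

lemma tAct_tAct (x : X F n) : tAct (tAct x) = x := rfl

lemma tAct_glAct (g : GL (Fin n) F) (x : X F n) :
    tAct (glAct g x) = glAct (contragredient g) (tAct x) := by
  have h1 : (contragredient g).val = (g⁻¹.val)ᵀ := rfl
  have h2 : ((contragredient g)⁻¹).val = (g.val)ᵀ := rfl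
  refine Prod.ext (Subtype.ext ?_) (Prod.ext ?_ ?_)
  · simp only [tAct, glAct, h1, h2, transpose_mul, mul_assoc]
  · simp only [tAct, glAct, h1, mulVec_transpose]
  · simp only [tAct, glAct, h2, vecMul_transpose]

/-- The action of `G̃_n` on `X_n`: `(g, s) x = g x` if `s = 1`, and `(g, s) x = g (T x)` if `s` is
the generator of `S₂`. -/
instance : MulAction (GTilde F n) (X F n) where
  smul a x := glAct a.left (if a.right = 1 then x else tAct x)
  one_smul x := glAct_one x
  mul_smul a b x := by
    change glAct (a.left * permAct F n a.right b.left)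
        (if a.right * b.right = 1 then x else tAct x) =
      glAct a.left (if a.right = 1 then glAct b.left (if b.right = 1 then x else tAct x)
        else tAct (glAct b.left (if b.right = 1 then x else tAct x)))
    rw [glAct_mul]
    congr 1
    rcases perm_two_eq a.right with h | h <;> rcases perm_two_eq b.right with h' | h' <;>
      simp [h, h', permAct, tAct_glAct, tAct_tAct]

lemma smul_def (a : GTilde F n) (x : X F n) :
    a • x = glAct a.left (if a.right = 1 then x else tAct x) := rfl

end Algebra

section Topology

lemma continuous_tAct {F : Type*} [Field F] [TopologicalSpace F] {n : ℕ} :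
     Continuous (tAct (F := F) (n := n)) := by
  refine Continuous.prodMk (Continuous.subtype_mk ?_ _) (Continuous.prodMk ?_ ?_)
  · fun_prop
  · fun_prop
  · fun_prop

variable {F : Type*} [Field F] [TopologicalSpace F] [IsTopologicalRing F] {n : ℕ}

lemma continuous_glAct (g : GL (Fin n) F) : Continuous (glAct (F := F) (n := n) g) := by
  refine Continuous.prodMk (Continuous.subtype_mk ?_ _) (Continuous.prodMk ?_ ?_)
  · fun_prop
  · fun_prop
  · fun_prop

instance : ContinuousConstSMul (GTilde F n) (X F n) where
  continuous_const_smul a := by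
    change Continuous fun x : X F n => glAct a.left (if a.right = 1 then x else tAct x)
    refine (continuous_glAct a.left).comp ?_
    split_ifs
    · exact continuous_id
    · exact continuous_tAct

/-- Conjugation `x ↦ g x g⁻¹` by `g ∈ GL_n` on `GL_{n+1}`, as a homeomorphism. -/
def conjHomeo (g : GL (Fin n) F) : GL (Fin (n + 1)) F ≃ₜ GL (Fin (n + 1)) F :=
  (Homeomorph.mulLeft (embGL F n g)).trans (Homeomorph.mulRight (embGL F n g)⁻¹)

lemma continuous_transposeGL : Continuous (transposeGL (F := F) (n := n)) := by
  refine Units.continuous_iff.2 ⟨?_, ?_⟩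
  · exact Units.continuous_val.matrix_transpose
  · exact (Units.continuous_val.comp continuous_inv).matrix_transpose

variable (F n) in
/-- Transposition on `GL_n`, as a homeomorphism. -/
def transposeHomeo : GL (Fin n) F ≃ₜ GL (Fin n) F where
  toFun := transposeGL
  invFun := transposeGL
  left_inv := transposeGL_transposeGL
  right_inv := transposeGL_transposeGL
  continuous_toFun := continuous_transposeGL
  continuous_invFun := continuous_transposeGL

end Topology

end MultOne

end

namespace MultOne

/-! ### Schwartz functions as combinations of indicator functions -/

/-! Transposition carries conjugation by `g` to conjugation by the contragredient of `g`, so for an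
invariant `ξ` the difference `η` of `ξ` and its transpose is conjugation-invariant and changes sign
under transposition. It must be shown that `η = 0`. Splitting a matrix into blocks, and the upper
left block into its traceless and scalar parts, puts `GL (n+1)` inside `X_n × F × F`. Conjugation
and transposition act as `G̃_n` on the first factor and fix the other two coordinates and the
determinant. Hence, for a compact open condition on these invariants (with determinants bounded away
from `0`), pulling functions back from `X_n` and cutting off gives an equivariant map into Schwartz
functions on `GL (n+1)` (`slabPullback`). Composed with `η` it is a `(G̃_n, χ)`-equivariant
distribution on `X_n`, zero by hypothesis (`isEquivariant_comp_slabPullback`). So `η` kills the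
indicators of all `boxes`. These form an intersection-stable basis, and their indicators span the
Schwartz functions (`SchwartzFun.mem_span_indicator`). -/

open TopologicalSpace in
/-- If a basis of the topology is stable under intersection, then the indicator functions of its
members span a space containing all Schwartz functions. -/
theorem SchwartzFun.mem_span_indicator {Z : Type*} [TopologicalSpace Z] {B : Set (Set Z)}
    (hB : IsTopologicalBasis B) (hinter : ∀ U ∈ B, ∀ V ∈ B, U ∩ V ∈ B) (f : SchwartzFun Z) :
    (f : Z → ℂ) ∈ Submodule.span ℂ ((fun U : Set Z => U.indicator (1 : Z → ℂ)) '' B) := by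
  set S := Submodule.span ℂ ((fun U : Set Z => U.indicator (1 : Z → ℂ)) '' B) with hS
  -- A product of indicators is the indicator of the intersection, so stability of `B` makes the
  -- span a ring.
  have hmul : ∀ a ∈ S, ∀ b ∈ S, a * b ∈ S := fun a ha b hb => by
    have h : a * b ∈ S * S := Submodule.mul_mem_mul ha hb
    rw [hS, Submodule.span_mul_span] at h
    refine Submodule.span_mono ?_ h
    rintro _ ⟨_, ⟨U, hU, rfl⟩, _, ⟨V, hV, rfl⟩, rfl⟩
    exact ⟨U ∩ V, hinter U hU V hV, by simp [← Set.inter_indicator_one]⟩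
  -- An `h` equal to `1` on the support gives `f = h * f`. Carrying it through the compactness
  -- induction avoids refining a cover to a disjoint one.
  obtain ⟨h, -, h1, hf⟩ : ∃ h ∈ S, (∀ z ∈ tsupport (f : Z → ℂ), h z = 1) ∧ h * f.1 ∈ S := by
    refine IsCompact.induction_on (p := fun s => ∃ h ∈ S, (∀ z ∈ s, h z = 1) ∧ h * f.1 ∈ S)
      f.2.2 ⟨0, S.zero_mem, by simp, by simp⟩ ?_ ?_ ?_
    · rintro s t hst ⟨h, hh, h1, hf⟩
      exact ⟨h, hh, fun z hz => h1 z (hst hz), hf⟩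
    · rintro s t ⟨h, hh, h1, hf⟩ ⟨k, hk, k1, kf⟩
      -- This is `1 - (1 - h) * (1 - k)`, which is `1` wherever `h` or `k` is.
      refine ⟨h + k - h * k, S.sub_mem (S.add_mem hh hk) (hmul _ hh _ hk), ?_, ?_⟩
      · rintro z (hz | hz)
        · simp [h1 z hz]
        · simp [k1 z hz]
      · rw [sub_mul, add_mul, mul_assoc]
        exact S.sub_mem (S.add_mem hf kf) (hmul _ hh _ kf)
    · intro z _
      obtain ⟨U, hU, hzU, hUf⟩ :=
        hB.exists_subset_of_mem_open (u := {y | f.1 y = f.1 z}) rfl (f.2.1 {f.1 z})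
      have hUS : U.indicator (1 : Z → ℂ) ∈ S := Submodule.subset_span ⟨U, hU, rfl⟩
      refine ⟨U, mem_nhdsWithin_of_mem_nhds ((hB.isOpen hU).mem_nhds hzU), _, hUS,
        fun y hy => Set.indicator_of_mem hy _, ?_⟩
      convert S.smul_mem (f.1 z) hUS using 1
      ext y
      by_cases hy : y ∈ U
      · simpa [hy] using hUf hy
      · simp [hy]
  convert hf using 1
  ext z
  by_cases hz : z ∈ tsupport (f : Z → ℂ)
  · simp [h1 z hz]
  · simp [image_eq_zero_of_notMem_tsupport hz]

open TopologicalSpace in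
/-- A distribution vanishing on the indicator functions of an intersection-stable basis is zero. -/
theorem Distribution.eq_zero_of_basis {Z : Type*} [TopologicalSpace Z] {B : Set (Set Z)}
    (hB : IsTopologicalBasis B) (hinter : ∀ U ∈ B, ∀ V ∈ B, U ∩ V ∈ B) (ξ : Distribution Z)
    (hξ : ∀ U ∈ B, ∃ f : SchwartzFun Z, (f : Z → ℂ) = U.indicator 1 ∧ ξ f = 0) : ξ = 0 := by
  ext f
  have h : (f : Z → ℂ) ∈ (LinearMap.ker ξ).map (SchwartzFun Z).subtype := by
    refine Submodule.span_le.2 ?_ (SchwartzFun.mem_span_indicator hB hinter f)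
    rintro _ ⟨U, hU, rfl⟩
    obtain ⟨f, hf, hf0⟩ := hξ U hU
    exact ⟨f, hf0, hf⟩
  obtain ⟨f', hf', hff'⟩ := h
  rw [← Subtype.ext hff']
  exact hf'

theorem isLocallyConstant_indicator {Z : Type*} [TopologicalSpace Z] {f : Z → ℂ}
    (hf : IsLocallyConstant f) {U : Set Z} (hU : IsClopen U) :
    IsLocallyConstant (U.indicator f) :=
  ((⟨f, hf⟩ : LocallyConstant Z ℂ).indicator hU).isLocallyConstant

/-- The indicator function of a compact open set, as a Schwartz function. -/
noncomputable def SchwartzFun.indicator {Z : Type*} [TopologicalSpace Z] [T2Space Z] (U : Set Z)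
    (ho : IsOpen U) (hc : IsCompact U) : SchwartzFun Z :=
  ⟨U.indicator 1, isLocallyConstant_indicator (IsLocallyConstant.const 1) ⟨hc.isClosed, ho⟩,
    HasCompactSupport.intro hc fun _ hx => Set.indicator_of_notMem hx _⟩

/-! ### Compact open sets -/

theorem prespectralSpace_of_totallyDisconnectedSpace {Z : Type*} [TopologicalSpace Z] [T2Space Z]
    [LocallyCompactSpace Z] [TotallyDisconnectedSpace Z] : PrespectralSpace Z where
  isTopologicalBasis := by
    refine TopologicalSpace.isTopologicalBasis_of_isOpen_of_nhds (fun _ h => h.1)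
      fun x U hxU hU => ?_
    obtain ⟨C, hC, hxC, hCU⟩ := exists_compact_subset hU hxU
    obtain ⟨V, hV, hxV, hVC⟩ := loc_compact_Haus_tot_disc_of_zero_dim.exists_subset_of_mem_open
      hxC isOpen_interior
    exact ⟨V, ⟨hV.2, hC.of_isClosed_subset hV.1 (hVC.trans interior_subset)⟩, hxV,
      (hVC.trans interior_subset).trans hCU⟩

section LocalField

variable (F : Type*) [Field F] [ValuativeRel F] [TopologicalSpace F] [IsNonarchimedeanLocalField F]

theorem t2Space_of_isNonarchimedeanLocalField : T2Space F := by
  let := IsTopologicalAddGroup.rightUniformSpace F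
  have := isUniformAddGroup_of_addCommGroup (G := F)
  infer_instance

theorem totallyDisconnectedSpace_of_isNonarchimedeanLocalField : TotallyDisconnectedSpace F := by
  let := IsTopologicalAddGroup.rightUniformSpace F
  have := isUniformAddGroup_of_addCommGroup (G := F)
  have : TotallySeparatedSpace F := by
    refine totallySeparatedSpace_iff_exists_isClopen.mpr fun x y hxy => ?_
    -- The open ball about `x` of radius `v (y - x)` is clopen, and the strict inequality excludes
    -- `y`.
    refine ⟨(fun z => z - x) ⁻¹' {z | Valued.v.restrict z < Valued.v.restrict (y - x)},
      (Valued.isClopen_ball F _).preimage (by fun_prop), ?_, ?_⟩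
    · have h : y - x ≠ 0 := sub_ne_zero.2 hxy.symm
      simp [zero_lt_iff, h]
    · simp
  infer_instance

end LocalField

/-! ### The topology of `GL_m` -/

section GeneralLinear

variable {F : Type*} [Field F] [TopologicalSpace F] [IsTopologicalDivisionRing F] {m : ℕ}

/-- The unit topology also records the inverse, but `det⁻¹ • adjugate` is continuous in the entries
on invertible matrices. -/
theorem isEmbedding_val_GL :
    Topology.IsEmbedding (Units.val : GL (Fin m) F → Matrix (Fin m) (Fin m) F) := by
  refine Units.isEmbedding_val_mk' (f := fun A => A.det⁻¹ • A.adjugate) ?_ fun u => ?_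
  · refine ContinuousOn.smul (ContinuousOn.inv₀ continuous_id.matrix_det.continuousOn
      fun A hA => ?_) continuous_id.matrix_adjugate.continuousOn
    exact ((isUnit_iff_isUnit_det A).1 hA).ne_zero
  · rw [coe_units_inv, inv_def, Ring.inverse_eq_inv']

/-- Since `K` is closed and omits `0`, the compact set `C ∩ det ⁻¹' K` of matrices consists of
invertible ones. -/
theorem isCompact_GL [T2Space F] {C : Set (Matrix (Fin m) (Fin m) F)} (hC : IsCompact C)
    {K : Set F} (hK : IsCompact K) (h0 : (0 : F) ∉ K) :
    IsCompact {g : GL (Fin m) F | g.val ∈ C ∧ g.val.det ∈ K} := by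
  refine isEmbedding_val_GL.isInducing.isCompact_preimage' (K := C ∩ det ⁻¹' K)
    (hC.inter_right (hK.isClosed.preimage (by fun_prop))) ?_
  rintro A ⟨-, hA⟩
  have h : IsUnit A := (isUnit_iff_isUnit_det A).2 (isUnit_iff_ne_zero.2 fun h => h0 (h ▸ hA))
  exact h

end GeneralLinear

/-! ### Coordinates on `(n+1) × (n+1)` matrices -/

section Coordinates

/-- The block form of an `(n+1) × (n+1)` matrix. -/
def blockForm {F : Type*} {n : ℕ} (x : Matrix (Fin (n + 1)) (Fin (n + 1)) F) :
    Matrix (Fin n ⊕ Fin 1) (Fin n ⊕ Fin 1) F :=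
  reindex finSumFinEquiv.symm finSumFinEquiv.symm x

variable {F : Type*} [Field F] {n : ℕ}

theorem blockForm_mul (x y : Matrix (Fin (n + 1)) (Fin (n + 1)) F) :
    blockForm (x * y) = blockForm x * blockForm y := by
  simp only [blockForm, reindex_apply, submatrix_mul_equiv]

theorem blockForm_embGL (g : GL (Fin n) F) :
    blockForm (embGL F n g).val = fromBlocks g.val 0 0 1 := by
  simp [blockForm, embGL]

theorem blockForm_conj (g : GL (Fin n) F) (x : Matrix (Fin (n + 1)) (Fin (n + 1)) F) :
    blockForm ((embGL F n g).val * x * (embGL F n g)⁻¹.val) =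
      fromBlocks (g.val * (blockForm x).toBlocks₁₁ * g⁻¹.val) (g.val * (blockForm x).toBlocks₁₂)
        ((blockForm x).toBlocks₂₁ * g⁻¹.val) (blockForm x).toBlocks₂₂ := by
  rw [← map_inv, blockForm_mul, blockForm_mul, blockForm_embGL, blockForm_embGL]
  conv_lhs => rw [← fromBlocks_toBlocks (blockForm x)]
  simp [fromBlocks_multiply]

/-- The trace-zero part of a square matrix. -/
def slPart [CharZero F] (A : Matrix (Fin n) (Fin n) F) : sl F n :=
  ⟨A - (trace A / n) • (1 : Matrix (Fin n) (Fin n) F), by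
    rw [LinearMap.mem_ker, traceLinearMap_apply, trace_sub, trace_smul, trace_one,
      Fintype.card_fin, smul_eq_mul]
    -- For `n = 0` the trace is an empty sum; otherwise characteristic zero makes `n` invertible.
    rcases Nat.eq_zero_or_pos n with rfl | hn
    · simp [trace]
    · rw [div_mul_cancel₀ _ (Nat.cast_ne_zero.2 hn.ne'), sub_self]⟩

/-- The `X_n`-coordinate of an `(n+1) × (n+1)` matrix. -/
def coordX [CharZero F] (x : Matrix (Fin (n + 1)) (Fin (n + 1)) F) : X F n :=
  (slPart (blockForm x).toBlocks₁₁, fun i => (blockForm x).toBlocks₁₂ i 0,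
    (blockForm x).toBlocks₂₁ 0)

/-- The two remaining coordinates of an `(n+1) × (n+1)` matrix: the trace of its upper left
`n × n` block and its lower right entry. -/
def coordF (x : Matrix (Fin (n + 1)) (Fin (n + 1)) F) : F × F :=
  (trace (blockForm x).toBlocks₁₁, (blockForm x).toBlocks₂₂ 0 0)

/-- The matrix with given coordinates. -/
def ofCoord (p : X F n × F × F) : Matrix (Fin (n + 1)) (Fin (n + 1)) F :=
  reindex finSumFinEquiv finSumFinEquiv
    (fromBlocks (p.1.1.val + (p.2.1 / n) • (1 : Matrix (Fin n) (Fin n) F))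
      (of fun i _ => p.1.2.1 i) (of fun _ j => p.1.2.2 j) (of fun _ _ => p.2.2))

/-- A one-sided inverse is enough for an embedding, and covers `n = 0`, where the trace coordinate
is always `0` and the coordinates are not surjective. -/
theorem ofCoord_coord [CharZero F] (x : Matrix (Fin (n + 1)) (Fin (n + 1)) F) :
    ofCoord (coordX x, coordF x) = x := by
  have h : fromBlocks ((blockForm x).toBlocks₁₁) (of fun i _ => (blockForm x).toBlocks₁₂ i 0)
      (of fun _ j => (blockForm x).toBlocks₂₁ 0 j) (of fun _ _ => (blockForm x).toBlocks₂₂ 0 0) =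
      blockForm x := by
    conv_rhs => rw [← fromBlocks_toBlocks (blockForm x)]
    congr 1 <;> ext i j
    · rw [of_apply, Subsingleton.elim j 0]
    · rw [of_apply, Subsingleton.elim i 0]
    · rw [of_apply, Subsingleton.elim i 0, Subsingleton.elim j 0]
  simp only [ofCoord, coordX, coordF, slPart, sub_add_cancel]
  rw [h]
  simp [blockForm]

theorem coordX_conj [CharZero F] (g : GL (Fin n) F) (x : Matrix (Fin (n + 1)) (Fin (n + 1)) F) :
    coordX ((embGL F n g).val * x * (embGL F n g)⁻¹.val) = glAct g (coordX x) := by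
  have ht (A : Matrix (Fin n) (Fin n) F) : trace (g.val * A * g⁻¹.val) = trace A := by
    rw [trace_mul_comm, ← mul_assoc, Units.inv_mul, one_mul]
  refine Prod.ext (Subtype.ext ?_) (Prod.ext ?_ ?_)
  · simp only [coordX, slPart, blockForm_conj, toBlocks_fromBlocks₁₁, glAct, ht, mul_sub, sub_mul,
      Matrix.mul_smul, Matrix.smul_mul, mul_one, Units.mul_inv]
  · simp only [coordX, blockForm_conj, toBlocks_fromBlocks₁₂, glAct]
    rfl
  · simp only [coordX, blockForm_conj, toBlocks_fromBlocks₂₁, glAct]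
    rfl

theorem coordF_conj (g : GL (Fin n) F) (x : Matrix (Fin (n + 1)) (Fin (n + 1)) F) :
    coordF ((embGL F n g).val * x * (embGL F n g)⁻¹.val) = coordF x := by
  simp only [coordF, blockForm_conj, toBlocks_fromBlocks₁₁, toBlocks_fromBlocks₂₂]
  rw [trace_mul_comm, ← mul_assoc, Units.inv_mul, one_mul]

theorem coordX_transpose [CharZero F] (x : Matrix (Fin (n + 1)) (Fin (n + 1)) F) :
    coordX xᵀ = tAct (coordX x) := by
  refine Prod.ext (Subtype.ext ?_) (Prod.ext ?_ ?_)
  · change (blockForm x).toBlocks₁₁ᵀ - (trace (blockForm x).toBlocks₁₁ᵀ / n) • 1 =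
      ((blockForm x).toBlocks₁₁ - (trace (blockForm x).toBlocks₁₁ / n) • 1)ᵀ
    simp
  · rfl
  · rfl

theorem coordF_transpose (x : Matrix (Fin (n + 1)) (Fin (n + 1)) F) :
    coordF xᵀ = coordF x := rfl

theorem det_conj_embGL (g : GL (Fin n) F) (x : Matrix (Fin (n + 1)) (Fin (n + 1)) F) :
    ((embGL F n g).val * x * (embGL F n g)⁻¹.val).det = x.det := by
  rw [det_mul_comm, ← mul_assoc, Units.inv_mul, one_mul]

theorem continuous_blockForm {F : Type*} [TopologicalSpace F] {n : ℕ} :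
    Continuous (blockForm (F := F) (n := n)) :=
  continuous_id.matrix_reindex _ _

variable [TopologicalSpace F] [IsTopologicalDivisionRing F]

theorem continuous_coordX [CharZero F] : Continuous (coordX (F := F) (n := n)) := by
  have := continuous_blockForm (F := F) (n := n)
  refine Continuous.prodMk (Continuous.subtype_mk ?_ _) (Continuous.prodMk ?_ ?_) <;>
    simp only [toBlocks₁₁, toBlocks₁₂, toBlocks₂₁] <;> fun_prop

theorem continuous_coordF : Continuous (coordF (F := F) (n := n)) := by
  have := continuous_blockForm (F := F) (n := n)
  refine Continuous.prodMk ?_ ?_ <;> simp only [toBlocks₁₁, toBlocks₂₂] <;> fun_prop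

theorem continuous_ofCoord : Continuous (ofCoord (F := F) (n := n)) := by
  refine Continuous.matrix_reindex (Continuous.matrix_fromBlocks ?_ ?_ ?_ ?_) _ _
  · fun_prop
  · exact continuous_matrix fun i j => by simp only [of_apply]; fun_prop
  · exact continuous_matrix fun i j => by simp only [of_apply]; fun_prop
  · exact continuous_matrix fun i j => by simp only [of_apply]; fun_prop

theorem isInducing_coord_GL [CharZero F] :
    Topology.IsInducing fun x : GL (Fin (n + 1)) F => (coordX x.val, coordF x.val) :=
  (Topology.IsEmbedding.of_leftInverse (f := ofCoord) ofCoord_coord continuous_ofCoord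
    (continuous_coordX.prodMk continuous_coordF)).isInducing.comp isEmbedding_val_GL.isInducing

end Coordinates

/-! ### From `GL_{n+1}` to `X_n` -/

section Descent

variable {F : Type*} [Field F] [TopologicalSpace F] {n : ℕ}

theorem map_conj_map_transpose [IsTopologicalRing F]
    {ξ : Distribution (GL (Fin (n + 1)) F)}
    (hξ : ∀ g : GL (Fin n) F, ξ.map (conjHomeo g) = ξ) (g : GL (Fin n) F) :
    (ξ.map (transposeHomeo F (n + 1))).map (conjHomeo g) = ξ.map (transposeHomeo F (n + 1)) := by
  have hemb (g : GL (Fin n) F) : transposeGL (embGL F n g) = embGL F n (transposeGL g) := by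
    refine Units.ext ?_
    change (embGL F n g).valᵀ = _
    simp [embGL, fromBlocks_transpose, transposeGL]
  -- Transposition intertwines conjugation by `g` with conjugation by its contragredient, which is
  -- again in `GL_n`.
  have he : (transposeHomeo F (n + 1)).trans (conjHomeo g) =
      (conjHomeo (contragredient g)).trans (transposeHomeo F (n + 1)) := by
    ext1 x
    change embGL F n g * transposeGL x * (embGL F n g)⁻¹ =
      transposeGL (embGL F n (transposeGL g⁻¹) * x * (embGL F n (transposeGL g⁻¹))⁻¹)
    rw [transposeGL_mul, transposeGL_mul, transposeGL_inv, hemb, transposeGL_transposeGL,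
      map_inv, inv_inv, mul_assoc]
  change ξ.map ((transposeHomeo F (n + 1)).trans (conjHomeo g)) = _
  rw [he]
  change (ξ.map (conjHomeo (contragredient g))).map (transposeHomeo F (n + 1)) = _
  rw [hξ]

/-- The set of elements of `GL_{n+1}` whose determinant lies in `K` and whose coordinates other
than the `X_n`-coordinate lie in `L`. -/
def slab (n : ℕ) (K : Set F) (L : Set (F × F)) : Set (GL (Fin (n + 1)) F) :=
  {x | x.val.det ∈ K ∧ coordF x.val ∈ L}

variable [CharZero F]

variable (F n) in
/-- The sets in `GL_{n+1}` cut out by compact open conditions on the determinant and on the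
coordinates. -/
def boxes : Set (Set (GL (Fin (n + 1)) F)) :=
  {W | ∃ (K : Set F) (L : Set (F × F)) (U : Set (X F n)), (IsCompact K ∧ IsOpen K ∧ (0 : F) ∉ K) ∧
    (IsCompact L ∧ IsOpen L) ∧ (IsCompact U ∧ IsOpen U) ∧
    W = slab n K L ∩ (fun x => coordX x.val) ⁻¹' U}

theorem inter_mem_boxes [T2Space F] {W W' : Set (GL (Fin (n + 1)) F)} (hW : W ∈ boxes F n)
    (hW' : W' ∈ boxes F n) : W ∩ W' ∈ boxes F n := by
  obtain ⟨K, L, U, ⟨hK, hKo, h0⟩, ⟨hL, hLo⟩, ⟨hU, hUo⟩, rfl⟩ := hW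
  obtain ⟨K', L', U', ⟨hK', hKo', -⟩, ⟨hL', hLo'⟩, ⟨hU', hUo'⟩, rfl⟩ := hW'
  refine ⟨K ∩ K', L ∩ L', U ∩ U', ⟨hK.inter hK', hKo.inter hKo', fun h => h0 h.1⟩,
    ⟨hL.inter hL', hLo.inter hLo'⟩, ⟨hU.inter hU', hUo.inter hUo'⟩, ?_⟩
  ext x
  simp only [slab, Set.mem_inter_iff, Set.mem_ofPred_eq, Set.mem_preimage]
  tauto

variable [IsTopologicalDivisionRing F]

theorem isCompact_slab_inter [T2Space F] {K : Set F} {L : Set (F × F)} {C : Set (X F n)}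
    (hK : IsCompact K) (h0 : (0 : F) ∉ K) (hL : IsCompact L) (hC : IsCompact C) :
    IsCompact (slab n K L ∩ (fun x => coordX x.val) ⁻¹' C) := by
  have hcl : IsClosed (slab n K L ∩ (fun x => coordX x.val) ⁻¹' C) :=
    ((hK.isClosed.preimage (Units.continuous_val.matrix_det)).inter
      (hL.isClosed.preimage (continuous_coordF.comp Units.continuous_val))).inter
      (hC.isClosed.preimage (continuous_coordX.comp Units.continuous_val))
  refine (isCompact_GL ((hC.prod hL).image continuous_ofCoord) hK h0).of_isClosed_subset hcl ?_
  rintro x ⟨⟨hd, hF⟩, hX⟩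
  exact ⟨⟨(coordX x.val, coordF x.val), ⟨hX, hF⟩, ofCoord_coord x.val⟩, hd⟩

/-- Pull-back of Schwartz functions from `X_n` to `GL_{n+1}`, cut off by a slab. -/
noncomputable def slabPullback [T2Space F] (n : ℕ) {K : Set F} {L : Set (F × F)}
    (hK : IsCompact K) (hKo : IsOpen K) (h0 : (0 : F) ∉ K) (hL : IsCompact L) (hLo : IsOpen L) :
    SchwartzFun (X F n) →ₗ[ℂ] SchwartzFun (GL (Fin (n + 1)) F) where
  toFun f := ⟨(slab n K L).indicator fun x => f.1 (coordX x.val), by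
    refine isLocallyConstant_indicator
      (f.2.1.comp_continuous (continuous_coordX.comp Units.continuous_val)) ⟨?_, ?_⟩
    · exact (hK.isClosed.preimage (Units.continuous_val.matrix_det)).inter
        (hL.isClosed.preimage (continuous_coordF.comp Units.continuous_val))
    · exact (hKo.preimage (Units.continuous_val.matrix_det)).inter
        (hLo.preimage (continuous_coordF.comp Units.continuous_val)), by
    refine HasCompactSupport.intro (isCompact_slab_inter hK h0 hL f.2.2) fun x hx => ?_
    refine Set.indicator_apply_eq_zero.2 fun hxs => ?_
    exact image_eq_zero_of_notMem_tsupport fun h => hx ⟨hxs, h⟩⟩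
  map_add' f g := Subtype.ext (Set.indicator_add (slab n K L) (fun x => f.1 (coordX x.val))
    fun x => g.1 (coordX x.val))
  map_smul' c f := Subtype.ext (Set.indicator_const_smul (slab n K L) c fun x => f.1 (coordX x.val))

/-- The slab depends only on quantities that `e` preserves, so `e` acts only through the
`X_n`-coordinate. -/
theorem comap_slabPullback [T2Space F] {K : Set F} {L : Set (F × F)}
    (hK : IsCompact K) (hKo : IsOpen K) (h0 : (0 : F) ∉ K) (hL : IsCompact L) (hLo : IsOpen L)
    (e : GL (Fin (n + 1)) F ≃ₜ GL (Fin (n + 1)) F) (h : GTilde F n)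
    (hX : ∀ x, coordX (e x).val = h • coordX x.val) (hF : ∀ x, coordF (e x).val = coordF x.val)
    (hdet : ∀ x, (e x).val.det = x.val.det) (f : SchwartzFun (X F n)) :
    SchwartzFun.comap e (slabPullback n hK hKo h0 hL hLo f) =
      slabPullback n hK hKo h0 hL hLo (SchwartzFun.comap (Homeomorph.smul h) f) := by
  refine Subtype.ext (funext fun x => ?_)
  change (slab n K L).indicator (fun x => f.1 (coordX x.val)) (e x) =
    (slab n K L).indicator (fun x => f.1 (h • coordX x.val)) x
  have hs : e x ∈ slab n K L ↔ x ∈ slab n K L := by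
    simp only [slab, Set.mem_ofPred_eq, hdet, hF]
  by_cases hx : x ∈ slab n K L
  · rw [Set.indicator_of_mem hx, Set.indicator_of_mem (hs.2 hx), hX]
  · rw [Set.indicator_of_notMem hx, Set.indicator_of_notMem (mt hs.1 hx)]

theorem isEquivariant_comp_slabPullback [T2Space F] {K : Set F} {L : Set (F × F)}
    (hK : IsCompact K) (hKo : IsOpen K) (h0 : (0 : F) ∉ K) (hL : IsCompact L) (hLo : IsOpen L)
    {η : Distribution (GL (Fin (n + 1)) F)} (hη : ∀ g : GL (Fin n) F, η.map (conjHomeo g) = η)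
    (hT : η.map (transposeHomeo F (n + 1)) = -η) :
    Distribution.IsEquivariant (chi F n) (η ∘ₗ slabPullback n hK hKo h0 hL hLo) := by
  intro h
  -- Each `h` lifts to `GL (n+1)`: a conjugation, preceded by transposition when `h` lies outside
  -- `GL_n`. The sign in `hT` is then the value of `χ`.
  obtain ⟨e, hX, hF, hdet, he⟩ : ∃ e : GL (Fin (n + 1)) F ≃ₜ GL (Fin (n + 1)) F,
      (∀ x, coordX (e x).val = h • coordX x.val) ∧ (∀ x, coordF (e x).val = coordF x.val) ∧
      (∀ x, (e x).val.det = x.val.det) ∧ η.map e = (chi F n h : ℂ) • η := by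
    rcases perm_two_eq h.right with hr | hr
    · refine ⟨conjHomeo h.left, fun x => ?_, fun x => coordF_conj _ _,
        fun x => det_conj_embGL _ _, ?_⟩
      · rw [smul_def, if_pos hr]
        exact coordX_conj _ _
      · simp [hη, chi, hr]
    · refine ⟨(transposeHomeo F (n + 1)).trans (conjHomeo h.left), fun x => ?_,
        fun x => (coordF_conj _ _).trans (coordF_transpose _),
        fun x => (det_conj_embGL _ _).trans (det_transpose _), ?_⟩
      · rw [smul_def, if_neg (by rw [hr]; decide), ← coordX_transpose]
        exact coordX_conj _ _
      · change (η.map (transposeHomeo F (n + 1))).map (conjHomeo h.left) = _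
        rw [hT]
        change -(η.map (conjHomeo h.left)) = _
        simp [hη, chi, hr]
  ext f
  change η (slabPullback n hK hKo h0 hL hLo (SchwartzFun.comap (Homeomorph.smul h) f)) =
    (chi F n h : ℂ) • η (slabPullback n hK hKo h0 hL hLo f)
  rw [← comap_slabPullback hK hKo h0 hL hLo e h hX hF hdet]
  exact LinearMap.congr_fun he _

theorem isTopologicalBasis_boxes [T2Space F] [LocallyCompactSpace F] [TotallyDisconnectedSpace F] :
    TopologicalSpace.IsTopologicalBasis (boxes F n) := by
  have : PrespectralSpace F := prespectralSpace_of_totallyDisconnectedSpace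
  have : PrespectralSpace (F × F) := prespectralSpace_of_totallyDisconnectedSpace
  have hsl : IsClosed (sl F n : Set (Matrix (Fin n) (Fin n) F)) :=
    isClosed_singleton.preimage (f := fun A : Matrix (Fin n) (Fin n) F => A.trace)
      continuous_id.matrix_trace
  have : LocallyCompactSpace (Matrix (Fin n) (Fin n) F) :=
    inferInstanceAs (LocallyCompactSpace (Fin n → Fin n → F))
  have : TotallyDisconnectedSpace (Matrix (Fin n) (Fin n) F) :=
    inferInstanceAs (TotallyDisconnectedSpace (Fin n → Fin n → F))
  have : LocallyCompactSpace (sl F n) := hsl.isClosedEmbedding_subtypeVal.locallyCompactSpace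
  have : PrespectralSpace (X F n) := prespectralSpace_of_totallyDisconnectedSpace
  refine TopologicalSpace.isTopologicalBasis_of_isOpen_of_nhds ?_ fun x W hxW hW => ?_
  · rintro _ ⟨K, L, U, ⟨-, hKo, -⟩, ⟨-, hLo⟩, ⟨-, hUo⟩, rfl⟩
    exact ((hKo.preimage (Units.continuous_val.matrix_det)).inter
      (hLo.preimage (continuous_coordF.comp Units.continuous_val))).inter
      (hUo.preimage (continuous_coordX.comp Units.continuous_val))
  · obtain ⟨K, ⟨hKo, hK⟩, hxK, h0⟩ :=
      (PrespectralSpace.isTopologicalBasis (X := F)).exists_subset_of_mem_open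
        (u := {0}ᶜ) (a := x.val.det) ((isUnit_iff_isUnit_det _).1 x.isUnit).ne_zero
        isOpen_compl_singleton
    -- The coordinates alone determine the topology; the determinant condition only makes the box
    -- compact.
    obtain ⟨O, hO, rfl⟩ := isInducing_coord_GL.isOpen_iff.1 hW
    obtain ⟨P, Q, hP, hQ, hxP, hxQ, hPQ⟩ := isOpen_prod_iff.1 hO _ _ hxW
    obtain ⟨U, ⟨hUo, hU⟩, hxU, hUP⟩ :=
      PrespectralSpace.isTopologicalBasis.exists_subset_of_mem_open hxP hP
    obtain ⟨L, ⟨hLo, hL⟩, hxL, hLQ⟩ :=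
      PrespectralSpace.isTopologicalBasis.exists_subset_of_mem_open hxQ hQ
    refine ⟨_, ⟨K, L, U, ⟨hK, hKo, fun h => h0 h rfl⟩, ⟨hL, hLo⟩, ⟨hU, hUo⟩, rfl⟩,
      ⟨⟨hxK, hxL⟩, hxU⟩, ?_⟩
    rintro y ⟨⟨-, hyL⟩, hyU⟩
    exact hPQ ⟨hUP hyU, hLQ hyL⟩

theorem eq_zero_of_map_conj_of_map_transpose [T2Space F] [LocallyCompactSpace F]
    [TotallyDisconnectedSpace F]
    (main : ∀ ξ : Distribution (X F n), ξ.IsEquivariant (chi F n) → ξ = 0)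
    {η : Distribution (GL (Fin (n + 1)) F)} (hη : ∀ g : GL (Fin n) F, η.map (conjHomeo g) = η)
    (hT : η.map (transposeHomeo F (n + 1)) = -η) : η = 0 := by
  refine Distribution.eq_zero_of_basis isTopologicalBasis_boxes
    (fun _ hW _ hW' => inter_mem_boxes hW hW') η ?_
  rintro _ ⟨K, L, U, ⟨hK, hKo, h0⟩, ⟨hL, hLo⟩, ⟨hU, hUo⟩, rfl⟩
  refine ⟨slabPullback n hK hKo h0 hL hLo (SchwartzFun.indicator U hUo hU), ?_,
    LinearMap.congr_fun
      (main _ (isEquivariant_comp_slabPullback hK hKo h0 hL hLo hη hT)) _⟩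
  -- The indicator of a box is the slab pullback of the indicator of `U`.
  rw [← Set.indicator_indicator]
  rfl

end Descent

end MultOne

theorem mainTheorem4 (F : Type*) [Field F] [ValuativeRel F] [TopologicalSpace F]
    [IsNonarchimedeanLocalField F] [CharZero F] (n : ℕ)
    (main : ∀ ξ : MultOne.Distribution (MultOne.X F n),
      ξ.IsEquivariant (MultOne.chi F n) → ξ = 0) :
    ∀ ξ : MultOne.Distribution (GL (Fin (n + 1)) F),
      (∀ g : GL (Fin n) F, ξ.map (MultOne.conjHomeo g) = ξ) →
        ξ.map (MultOne.transposeHomeo F (n + 1)) = ξ := by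
  intro ξ hξ
  have := MultOne.t2Space_of_isNonarchimedeanLocalField F
  have := MultOne.totallyDisconnectedSpace_of_isNonarchimedeanLocalField F
  set τ := ξ.map (MultOne.transposeHomeo F (n + 1)) with hτ
  have hττ : τ.map (MultOne.transposeHomeo F (n + 1)) = ξ := by
    ext f
    rfl
  refine (sub_eq_zero.1 (MultOne.eq_zero_of_map_conj_of_map_transpose main (η := ξ - τ)
    (fun g => ?_) ?_)).symm
  · change ξ.map _ - τ.map _ = _
    rw [hξ, hτ, MultOne.map_conj_map_transpose hξ]
  · change ξ.map _ - τ.map _ = _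
    rw [hττ, neg_sub]
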